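/- **Theorem (Characterization of congruences).** Let $\mathbf A,\mathbf B$ be bounded distributive lattices and let $\mathcal M=\langle \mathbf A,\mathbf B,f,i\rangle$ be a FIDL-module: $f:A\times B\to A$ and $i:B\times A\to A$ satisfy, for all $x,y\in A$ and $b,c\in B$, $f(x\vee y,b)=f(x,b)\vee f(y,b)$, $f(x,b\vee c)=f(x,b)\vee f(x,c)$, $f(0,b)=0=f(x,0)$, $i(b,x\wedge y)=i(b,x)\wedge i(b,y)$, $i(b\vee c,x)=i(b,x)\wedge i(c,x)$, $i(b,1)=1$. For a bounded distributive lattice $\mathbf L$ let $\mathcal X(\mathbf L)$ be the set of its prime (proper) filters, ordered by inclusion, with the topology having as subbase the sets $\beta(a)=\{P: a\in P\}$ and their complements ($a\in L$). For a closed set $Y\subseteq\mathcal X(\mathbf L)$ let $\theta(Y)=\{(a,b)\in L^2:\beta(a)\cap Y=\beta(b)\cap Y\}$, a congruence of $\mathbf L$. The Urquhart space $\mathcal F_{\mathcal M}$ of $\mathcal M$ consists of $X=\mathcal X(\mathbf A)$ and $Y=\mathcal X(\mathbf B)$ with the relations $R\subseteq X\times Y\times X$ and $T\subseteq Y\times X\times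 X$, where $(Q,S,P)\in R$ iff every $x\in A$ with $f(q,s)\le x$ for some $q\in Q$, $s\in S$ lies in $P$, and $(S,P,Q)\in T$ iff every $x\in A$ with $p\le i(s,x)$ for some $s\in S$, $p\in P$ lies in $Q$. For $P\in X$ let $\mathrm{Max}(R^{-1}(P))$ be the set of pairs $(Q,S)\in X\times Y$ such that $Q$ is a maximal element of $\{Q'\in X:(Q',S,P)\in R\}$ and $S$ is a maximal element of $\{S'\in Y:(Q,S',P)\in R\}$; let $\mathcal D(P)$ be the set of pairs $(S,Q)\in Y\times X$ such that $S$ is a maximal element of $\{S'\in Y:(S',P,Q)\in T\}$ and $Q$ is a minimal element of $\{Q'\in X:(S,P,Q')\in T\}$. A pair $(Z_1,Z_2)$ of closed sets $Z_1\subseteq X$, $Z_2\subseteq Y$ is *$R$-closed* if $\mathrm{Max}(R^{-1}(P))\subseteq Z_1\times Z_2$ for all $P\in Z_1$, *$T$-closed* if $\mathcal D(P)\subseteq Z_2\times Z_1$ for all $P\in Z_1$, and *strongly closed* if it is both. A pair $(\theta_A,\theta_B)$ of a congruence of $\mathbf A$ and a congruence of $\mathbf B$ is an *FDL-congruence* if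 $(f(a,b),f(c,d))\in\theta_A$ whenever $(a,c)\in\theta_A$ and $(b,d)\in\theta_B$, an *IDL-congruence* if $(i(b,a),i(d,c))\in\theta_A$ whenever $(a,c)\in\theta_A$ and $(b,d)\in\theta_B$, and an *FIDL-congruence* if it is both. All sets of pairs are ordered by componentwise inclusion. Then the map $(Z_1,Z_2)\mapsto(\theta(Z_1),\theta(Z_2))$ restricts to the following order anti-isomorphisms: 1. from the $R$-closed pairs onto the FDL-congruences of $\mathcal M$; 2. from the $T$-closed pairs onto the IDL-congruences of $\mathcal M$, provided $i(0,x)=1$ for all $x\in A$; 3. from the strongly closed pairs onto the FIDL-congruences of $\mathcal M$, provided $i(0,x)=1$ for all $x\in A$. -/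

import Mathlib

open TopologicalSpace

universe u v

/-! ### Modules with fusion and implication over bounded distributive lattices -/

/-- A fusion `f : A × B → A` preserving finite joins (including the empty one) in each variable. -/
structure FDLModule (A : Type u) (B : Type v) [DistribLattice A] [BoundedOrder A]
    [DistribLattice B] [BoundedOrder B] where
  f : A → B → A
  f_sup_left : ∀ (x y : A) (b : B), f (x ⊔ y) b = f x b ⊔ f y b
  f_sup_right : ∀ (x : A) (b c : B), f x (b ⊔ c) = f x b ⊔ f x c
  f_bot_left : ∀ b : B, f ⊥ b = ⊥
  f_bot_right : ∀ x : A, f x ⊥ = ⊥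

/-- An implication `i : B × A → A`. -/
structure IDLModule (A : Type u) (B : Type v) [DistribLattice A] [BoundedOrder A]
    [DistribLattice B] [BoundedOrder B] where
  i : B → A → A
  i_inf : ∀ (b : B) (x y : A), i b (x ⊓ y) = i b x ⊓ i b y
  i_sup : ∀ (b c : B) (x : A), i (b ⊔ c) x = i b x ⊓ i c x
  i_top : ∀ b : B, i b ⊤ = ⊤

/-- A FIDL-module `⟨A, B, f, i⟩`. -/
structure FIDLModule (A : Type u) (B : Type v) [DistribLattice A] [BoundedOrder A]
    [DistribLattice B] [BoundedOrder B] extends FDLModule A B, IDLModule A B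

/-! ### The Priestley space of prime filters -/

/-- The set of prime (in particular proper) filters of `A`. -/
def PrimeFilter (A : Type u) [DistribLattice A] [BoundedOrder A] : Type u :=
  {P : Order.PFilter A // P.IsPrime}

namespace PrimeFilter

variable {A : Type u} [DistribLattice A] [BoundedOrder A]

/-- Prime filters are ordered by inclusion. -/
instance : PartialOrder (PrimeFilter A) :=
  inferInstanceAs (PartialOrder {P : Order.PFilter A // P.IsPrime})

/-- The underlying set of a prime filter. -/
def carrier (P : PrimeFilter A) : Set A := (P.1 : Set A)

/-- `β(a)`, the set of prime filters that contain `a`. -/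
def beta (a : A) : Set (PrimeFilter A) := {P | a ∈ P.carrier}

/-- The Priestley topology, with subbase the sets `β(a)` and their complements. -/
instance : TopologicalSpace (PrimeFilter A) :=
  generateFrom (Set.range (beta (A := A)) ∪ Set.range (fun a : A => (beta a)ᶜ))

theorem beta_inf (a b : A) : beta (a ⊓ b) = beta a ∩ beta b := by
  ext P
  exact Order.PFilter.inf_mem_iff

theorem beta_sup (a b : A) : beta (a ⊔ b) = beta a ∪ beta b := by
  ext P
  constructor
  · intro h
    by_contra hn
    have ha : a ∈ (P.1 : Set A)ᶜ := fun h' => hn (Or.inl h')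
    have hb : b ∈ (P.1 : Set A)ᶜ := fun h' => hn (Or.inr h')
    have hI := P.2.compl_ideal.toIdeal.sup_mem (x := a) (y := b) ha hb
    exact hI h
  · rintro (h | h)
    · exact P.1.mem_of_le le_sup_left h
    · exact P.1.mem_of_le le_sup_right h

end PrimeFilter

/-- The congruence `θ(Y) = {(a, b) | β(a) ∩ Y = β(b) ∩ Y}` attached to a set of prime filters. -/
def theta {A : Type u} [DistribLattice A] [BoundedOrder A] (Y : Set (PrimeFilter A)) :
    LatticeCon A where
  r a b := PrimeFilter.beta a ∩ Y = PrimeFilter.beta b ∩ Y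
  iseqv := ⟨fun _ => rfl, fun h => h.symm, fun h h' => h.trans h'⟩
  inf := by
    intro w x y z h h'
    rw [PrimeFilter.beta_inf, PrimeFilter.beta_inf, Set.inter_inter_distrib_right, h, h',
      ← Set.inter_inter_distrib_right]
  sup := by
    intro w x y z h h'
    rw [PrimeFilter.beta_sup, PrimeFilter.beta_sup, Set.union_inter_distrib_right, h, h',
      ← Set.union_inter_distrib_right]

/-- Congruences of a lattice are ordered by inclusion. -/
instance {L : Type u} [Lattice L] : PartialOrder (LatticeCon L) :=
  PartialOrder.lift LatticeCon.toSetoid (by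
    rintro ⟨s, _, _⟩ ⟨t, _, _⟩ h
    cases h
    rfl)

/-! ### Relational bi-spaces and their closed pairs -/

/-- A pair of relations `R ⊆ X × Y × X` and `T ⊆ Y × X × X`, the relational part of a structure
`⟨X, Y, ≤, ≤, τ, τ, R, T⟩`. -/
structure BiRel (X : Type u) (Y : Type v) where
  R : X → Y → X → Prop
  T : Y → X → X → Prop

namespace BiRel

variable {X : Type u} {Y : Type v} [PartialOrder X] [PartialOrder Y]

/-- `R¹(y, z)`: the maximal elements of `{x | (x, y, z) ∈ R}`. -/
def R1 (U : BiRel X Y) (y : Y) (z : X) : Set X := {x | Maximal (fun x' => U.R x' y z) x}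

/-- `R²(x, z)`: the maximal elements of `{y | (x, y, z) ∈ R}`. -/
def R2 (U : BiRel X Y) (x z : X) : Set Y := {y | Maximal (fun y' => U.R x y' z) y}

/-- `T¹(x, z)`: the maximal elements of `{y | (y, x, z) ∈ T}`. -/
def T1 (U : BiRel X Y) (x z : X) : Set Y := {y | Maximal (fun y' => U.T y' x z) y}

/-- `T³(y, x)`: the minimal elements of `{z | (y, x, z) ∈ T}`. -/
def T3 (U : BiRel X Y) (y : Y) (x : X) : Set X := {z | Minimal (fun z' => U.T y x z') z}

/-- `Max(R⁻¹(z))`. -/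
def maxR (U : BiRel X Y) (z : X) : Set (X × Y) := {p | p.1 ∈ U.R1 p.2 z ∧ p.2 ∈ U.R2 p.1 z}

/-- `𝒟(x)`. -/
def D (U : BiRel X Y) (x : X) : Set (Y × X) := {p | p.1 ∈ U.T1 x p.2 ∧ p.2 ∈ U.T3 p.1 x}

variable [TopologicalSpace X] [TopologicalSpace Y]

/-- A pair of closed sets is `R`-closed. -/
def IsRClosed (U : BiRel X Y) (Z : Closeds X × Closeds Y) : Prop :=
  ∀ z ∈ Z.1, U.maxR z ⊆ (Z.1 : Set X) ×ˢ (Z.2 : Set Y)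

/-- A pair of closed sets is `T`-closed. -/
def IsTClosed (U : BiRel X Y) (Z : Closeds X × Closeds Y) : Prop :=
  ∀ x ∈ Z.1, U.D x ⊆ (Z.2 : Set Y) ×ˢ (Z.1 : Set X)

/-- A pair of closed sets is strongly closed. -/
def IsStronglyClosed (U : BiRel X Y) (Z : Closeds X × Closeds Y) : Prop :=
  U.IsRClosed Z ∧ U.IsTClosed Z

end BiRel

/-! ### The dual space and the congruences of a FIDL-module -/

namespace FIDLModule

variable {A : Type u} {B : Type v} [DistribLattice A] [BoundedOrder A]
  [DistribLattice B] [BoundedOrder B]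

/-- `f(G, H) = {x | ∃ g ∈ G, ∃ h ∈ H, f(g, h) ≤ x}`. -/
def fSet (M : FIDLModule A B) (G : Set A) (H : Set B) : Set A :=
  {x | ∃ g ∈ G, ∃ h ∈ H, M.f g h ≤ x}

/-- `i(H, G) = {x | ∃ h ∈ H, ∃ g ∈ G, g ≤ i(h, x)}`. -/
def iSet (M : FIDLModule A B) (H : Set B) (G : Set A) : Set A :=
  {x | ∃ h ∈ H, ∃ g ∈ G, g ≤ M.i h x}

/-- The relations `R_M` and `T_M` on the Priestley spaces of `A` and `B`; together with the order
and the topology of these spaces they make up the dual space of `M`. -/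
def dualSpace (M : FIDLModule A B) : BiRel (PrimeFilter A) (PrimeFilter B) where
  R Q S P := M.fSet Q.carrier S.carrier ⊆ P.carrier
  T S P Q := M.iSet S.carrier P.carrier ⊆ Q.carrier

/-- FDL-congruences. -/
def IsFDLCon (M : FIDLModule A B) (t : LatticeCon A × LatticeCon B) : Prop :=
  ∀ ⦃a c : A⦄ ⦃b d : B⦄, t.1.r a c → t.2.r b d → t.1.r (M.f a b) (M.f c d)

/-- IDL-congruences. -/
def IsIDLCon (M : FIDLModule A B) (t : LatticeCon A × LatticeCon B) : Prop :=
  ∀ ⦃a c : A⦄ ⦃b d : B⦄, t.1.r a c → t.2.r b d → t.1.r (M.i b a) (M.i d c)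

/-- FIDL-congruences. -/
def IsFIDLCon (M : FIDLModule A B) (t : LatticeCon A × LatticeCon B) : Prop :=
  M.IsFDLCon t ∧ M.IsIDLCon t

end FIDLModule

/-!
A congruence of a bounded distributive lattice is determined by the prime filters that are
saturated for it, and a prime filter is saturated for `θ(Z)`, with `Z` closed, only if it lies in
`Z`. So the pairs of closed sets correspond to the pairs of congruences, and closedness under
`Max(R⁻¹(P))` has to be matched with compatibility of `f`.

If an ideal `I` is saturated for a congruence, then so is every prime filter that is maximal among
those disjoint from `I`. Now `(Q, S, P) ∈ R` says that `Q` avoids the ideal of the `x` with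
`f(x, s) ∉ P` for some `s ∈ S`, and for compatible `f` this ideal is saturated as soon as `P` is;
hence the components of a maximal pair are saturated. Conversely, if `f(a, b) ∈ P`, there is a
maximal pair `(Q, S)` with `a ∈ Q` and `b ∈ S`, and when `Q` and `S` are saturated, `a` and `b` may
be replaced by congruent elements.

When `i(0, x) = 1`, the implication, read as a map `B × Aᵒᵈ → Aᵒᵈ`, preserves finite joins in each
variable. Complementation turns prime filters of `A` into prime filters of `Aᵒᵈ`, reversing
inclusion, and `T` and `𝒟(P)` into the relation and the maximal pairs of this map. So the statement
on implications is the one on fusions, for maps `L × M → N` between three lattices.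
-/

open Order OrderDual
open scoped Relator

namespace PrimeFilter

section

variable {L : Type*} [DistribLattice L] [BoundedOrder L]

theorem mem_of_le (P : PrimeFilter L) {a b : L} (h : a ≤ b) (ha : a ∈ P.carrier) :
    b ∈ P.carrier :=
  P.1.mem_of_le h ha

theorem top_mem (P : PrimeFilter L) : ⊤ ∈ P.carrier :=
  PFilter.top_mem

theorem bot_notMem (P : PrimeFilter L) : ⊥ ∉ P.carrier :=
  P.2.compl_ideal.toIdeal.bot_mem

theorem inf_mem_iff (P : PrimeFilter L) {a b : L} :
    a ⊓ b ∈ P.carrier ↔ a ∈ P.carrier ∧ b ∈ P.carrier :=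
  PFilter.inf_mem_iff

theorem sup_mem_iff (P : PrimeFilter L) {a b : L} :
    a ⊔ b ∈ P.carrier ↔ a ∈ P.carrier ∨ b ∈ P.carrier :=
  Set.ext_iff.1 (beta_sup a b) P

/-- The prime filter with a given underlying set. -/
def ofSet (F : Set L) (top : ⊤ ∈ F) (bot : ⊥ ∉ F) (upper : IsUpperSet F) (inf : InfClosed F)
    (sup : SupClosed Fᶜ) : PrimeFilter L :=
  ⟨(IsPFilter.of_def ⟨⊤, top⟩ inf.codirectedOn fun h => upper h).toPFilter,
    ⟨upper.compl, ⟨⊥, bot⟩, sup.directedOn⟩⟩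

/-- The complement of a prime filter, which is a prime filter of the order dual. -/
def compl (P : PrimeFilter L) : PrimeFilter Lᵒᵈ :=
  ofSet (ofDual ⁻¹' P.carrierᶜ) P.bot_notMem (fun h => h P.top_mem)
    (fun _ _ hab ha hb => ha (P.mem_of_le hab hb))
    (fun _ ha _ hb hab => (P.sup_mem_iff.1 hab).elim ha hb)
    (fun _ ha _ hb hab => hab (P.inf_mem_iff.2 ⟨not_not.1 ha, not_not.1 hb⟩))

theorem compl_le_compl_iff {P Q : PrimeFilter L} : P.compl ≤ Q.compl ↔ Q ≤ P :=
  Set.compl_subset_compl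

theorem compl_surjective : Function.Surjective (compl : PrimeFilter L → PrimeFilter Lᵒᵈ) := by
  intro P
  refine ⟨(P.compl : PrimeFilter Lᵒᵈᵒᵈ), ?_⟩
  exact Subtype.ext (SetLike.coe_injective (compl_compl P.carrier))

theorem maximal_compl_iff {p : PrimeFilter Lᵒᵈ → Prop} {Q : PrimeFilter L} :
    Maximal p Q.compl ↔ Minimal (fun Q' => p Q'.compl) Q := by
  simp only [Maximal, Minimal, compl_surjective.forall, compl_le_compl_iff]

/-! ### Separation by prime filters -/

theorem exists_subset_and_disjoint {F : PFilter L} {I : Ideal L} (h : Disjoint (F : Set L) I) :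
    ∃ P : PrimeFilter L, (F : Set L) ⊆ P.carrier ∧ Disjoint P.carrier I := by
  obtain ⟨J, hJ, hIJ, hFJ⟩ := DistribLattice.prime_ideal_of_disjoint_filter_ideal h
  exact ⟨⟨hJ.toPrimePair.F, hJ.toPrimePair.F_isPrime⟩, hFJ.subset_compl_right,
    Set.disjoint_left.2 fun _ hx hxI => hx (hIJ hxI)⟩

theorem exists_carrier_eq_biUnion {c : Set (PrimeFilter L)} (hc : IsChain (· ≤ ·) c)
    (hne : c.Nonempty) : ∃ U : PrimeFilter L, U.carrier = ⋃ Q ∈ c, Q.carrier := by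
  obtain ⟨Q₀, hQ₀⟩ := hne
  have bot : ⊥ ∉ ⋃ Q ∈ c, Q.carrier := by
    rw [Set.mem_iUnion₂]
    rintro ⟨Q, -, hQ⟩
    exact Q.bot_notMem hQ
  have upper : IsUpperSet (⋃ Q ∈ c, Q.carrier) :=
    isUpperSet_iUnion₂ fun Q _ _ _ hab ha => Q.mem_of_le hab ha
  have inf : InfClosed (⋃ Q ∈ c, Q.carrier) := by
    intro a ha b hb
    obtain ⟨Q, hQ, ha⟩ := Set.mem_iUnion₂.1 ha
    obtain ⟨Q', hQ', hb⟩ := Set.mem_iUnion₂.1 hb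
    rcases hc.total hQ hQ' with hle | hle
    · exact Set.mem_biUnion hQ' (Q'.inf_mem_iff.2 ⟨hle ha, hb⟩)
    · exact Set.mem_biUnion hQ (Q.inf_mem_iff.2 ⟨ha, hle hb⟩)
  have sup : SupClosed (⋃ Q ∈ c, Q.carrier)ᶜ := by
    intro a ha b hb hab
    obtain ⟨Q, hQ, hab⟩ := Set.mem_iUnion₂.1 hab
    exact (Q.sup_mem_iff.1 hab).elim (fun h => ha (Set.mem_biUnion hQ h)) fun h =>
      hb (Set.mem_biUnion hQ h)
  exact ⟨ofSet _ (Set.mem_biUnion hQ₀ Q₀.top_mem) bot upper inf sup, rfl⟩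

theorem exists_le_and_maximal_disjoint {I : Set L} (P : PrimeFilter L)
    (h : Disjoint P.carrier I) :
    ∃ Q, P ≤ Q ∧ Maximal (fun Q : PrimeFilter L => Disjoint Q.carrier I) Q := by
  refine zorn_le_nonempty₀ {Q : PrimeFilter L | Disjoint Q.carrier I} (fun c hcI hc Q₀ hQ₀ => ?_)
    P h
  obtain ⟨U, hU⟩ := exists_carrier_eq_biUnion hc ⟨Q₀, hQ₀⟩
  refine ⟨U, ?_, fun Q hQ => ?_⟩
  · change Disjoint U.carrier I
    rw [hU, Set.disjoint_iUnion₂_left]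
    exact fun Q hQ => hcI hQ
  · change Q.carrier ⊆ U.carrier
    rw [hU]
    exact Set.subset_biUnion_of_mem (u := PrimeFilter.carrier) hQ

theorem exists_mem_and_maximal_disjoint {I : Ideal L} {a : L} (ha : a ∉ I) :
    ∃ Q, a ∈ Q.carrier ∧ Maximal (fun Q : PrimeFilter L => Disjoint Q.carrier I) Q := by
  have hdisj : Disjoint (PFilter.principal a : Set L) I :=
    Set.disjoint_left.2 fun _ hx hxI => ha (I.lower hx hxI)
  obtain ⟨P, haP, hP⟩ := exists_subset_and_disjoint hdisj
  obtain ⟨Q, hPQ, hQ⟩ := P.exists_le_and_maximal_disjoint hP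
  exact ⟨Q, hPQ (haP le_rfl), hQ⟩

/-! ### The topology -/

theorem isOpen_beta (a : L) : IsOpen (beta a) :=
  isOpen_generateFrom_of_mem (Or.inl ⟨a, rfl⟩)

theorem isClosed_beta (a : L) : IsClosed (beta a) :=
  ⟨isOpen_generateFrom_of_mem (Or.inr ⟨a, rfl⟩)⟩

theorem beta_top : beta (⊤ : L) = Set.univ :=
  Set.eq_univ_of_forall top_mem

theorem beta_bot : beta (⊥ : L) = ∅ :=
  Set.eq_empty_of_forall_notMem bot_notMem

theorem isTopologicalBasis_beta_sdiff_beta :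
    IsTopologicalBasis (Set.range fun p : L × L => beta p.1 \ beta p.2) where
  exists_subset_inter := by
    rintro _ ⟨⟨a, b⟩, rfl⟩ _ ⟨⟨c, d⟩, rfl⟩ P hP
    have hinter : beta (a ⊓ c) \ beta (b ⊔ d) = (beta a \ beta b) ∩ (beta c \ beta d) := by
      rw [beta_inf, beta_sup]
      grind
    exact ⟨_, ⟨(a ⊓ c, b ⊔ d), rfl⟩, hinter.superset hP, hinter.subset⟩
  sUnion_eq := by
    refine Set.eq_univ_of_univ_subset (Set.subset_sUnion_of_mem ⟨(⊤, ⊥), ?_⟩)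
    simp only [beta_top, beta_bot, Set.sdiff_empty]
  eq_generateFrom := by
    refine le_antisymm (le_generateFrom ?_) (le_generateFrom ?_)
    · rintro _ ⟨⟨a, b⟩, rfl⟩
      exact (isOpen_beta a).sdiff (isClosed_beta b)
    · rintro _ (⟨a, rfl⟩ | ⟨a, rfl⟩)
      · refine isOpen_generateFrom_of_mem ⟨(a, ⊥), ?_⟩
        simp only [beta_bot, Set.sdiff_empty]
      · refine isOpen_generateFrom_of_mem ⟨(⊤, a), ?_⟩
        simp only [beta_top, Set.compl_eq_univ_sdiff]

end

end PrimeFilter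

open PrimeFilter

/-! ### Saturated prime filters -/

section Saturated

/-- A set is saturated for an equivalence relation if it is a union of equivalence classes. -/
def IsSaturated {α : Type*} (r : Setoid α) (s : Set α) : Prop :=
  ∀ ⦃a b⦄, r a b → a ∈ s → b ∈ s

theorem IsSaturated.mem_iff {α : Type*} {r : Setoid α} {s : Set α} (hs : IsSaturated r s) {a b : α}
    (hab : r a b) : a ∈ s ↔ b ∈ s :=
  ⟨hs hab, hs (r.symm hab)⟩

variable {L : Type*} [DistribLattice L] [BoundedOrder L]

/-- The closed set of the prime filters that are saturated for an equivalence relation. -/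
def saturatedPrimes (r : Setoid L) : Closeds (PrimeFilter L) where
  carrier := {P | IsSaturated r P.carrier}
  isClosed' := by
    have h : {P : PrimeFilter L | IsSaturated r P.carrier} =
        ⋂ (a) (b) (_ : r a b), (beta a)ᶜ ∪ beta b := by
      ext P
      simp only [IsSaturated, Set.mem_iInter, Set.mem_union, ← imp_iff_not_or, Set.mem_compl_iff]
      rfl
    rw [h]
    exact isClosed_iInter fun a => isClosed_iInter fun b => isClosed_iInter fun _ =>
      (isOpen_beta a).isClosed_compl.union (isClosed_beta b)

/-- The saturation of a filter for a congruence: the elements whose class lies above the class of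
an element of the filter. -/
def saturation (t : LatticeCon L) (F : PFilter L) : PFilter L :=
  IsPFilter.toPFilter (F := {x | ∃ q ∈ F, t.r (q ⊓ x) q}) <| by
    refine .of_def ⟨⊤, ⊤, F.top_mem, ?_⟩ (InfClosed.codirectedOn ?_) ?_
    · rw [inf_top_eq]
    · rintro x ⟨q, hq, hx⟩ y ⟨q', hq', hy⟩
      refine ⟨q ⊓ q', F.inf_mem hq hq', ?_⟩
      rw [inf_inf_inf_comm]
      exact t.inf hx hy
    · rintro x y hxy ⟨q, hq, hx⟩
      have hsup := t.sup hx (t.refl (q ⊓ y))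
      rw [sup_eq_right.2 (inf_le_inf_left q hxy), sup_inf_self] at hsup
      exact ⟨q, hq, hsup⟩

theorem le_saturation (t : LatticeCon L) (F : PFilter L) : F ≤ saturation t F := by
  refine fun x hx => ⟨x, hx, ?_⟩
  change t.r (x ⊓ x) x
  rw [inf_idem]

theorem isSaturated_of_maximal_disjoint {t : LatticeCon L} {I : Ideal L}
    (hI : IsSaturated t.toSetoid I) {Q : PrimeFilter L}
    (hQ : Maximal (fun Q : PrimeFilter L => Disjoint Q.carrier I) Q) :
    IsSaturated t.toSetoid Q.carrier := by
  have hdisj : Disjoint (saturation t Q.1 : Set L) I := Set.disjoint_left.2 <| by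
    rintro x ⟨q, hq, hqx⟩ hx
    exact Set.disjoint_left.1 hQ.prop hq (hI hqx (I.lower inf_le_right hx))
  obtain ⟨P, hP, hPI⟩ := exists_subset_and_disjoint hdisj
  have hsub : (saturation t Q.1 : Set L) ⊆ Q.carrier :=
    hP.trans (hQ.le_of_ge hPI ((le_saturation t Q.1).trans hP))
  intro a b hab ha
  refine hsub ⟨a, ha, ?_⟩
  have hinf := t.inf (t.refl a) (t.symm hab)
  rwa [inf_idem] at hinf

theorem exists_saturated_mem_notMem {t : LatticeCon L} {a c : L} (h : ¬ t.r (a ⊓ c) a) :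
    ∃ P : PrimeFilter L, IsSaturated t.toSetoid P.carrier ∧ a ∈ P.carrier ∧ c ∉ P.carrier := by
  let I : Ideal L := IsIdeal.toIdeal (I := {x | t.r (x ⊓ c) x}) <| by
    refine ⟨fun x y hyx hx => ?_, ⟨⊥, ?_⟩, SupClosed.directedOn fun x hx y hy => ?_⟩
    · have hinf := t.inf (t.refl y) hx
      rwa [← inf_assoc, inf_eq_left.2 hyx] at hinf
    · rw [Set.mem_ofPred_eq, bot_inf_eq]
    · have hsup := t.sup hx hy
      rwa [← inf_sup_right] at hsup
  have hcI : c ∈ I := by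
    change t.r (c ⊓ c) c
    rw [inf_idem]
  have hI : IsSaturated t.toSetoid I := fun x y hxy hx =>
    t.trans (t.inf (t.symm hxy) (t.refl c)) (t.trans hx hxy)
  obtain ⟨P, haP, hP⟩ := exists_mem_and_maximal_disjoint (I := I) h
  exact ⟨P, isSaturated_of_maximal_disjoint hI hP, haP, fun hc =>
    Set.disjoint_left.1 hP.prop hc hcI⟩

theorem r_iff_forall_isSaturated {t : LatticeCon L} {a b : L} :
    t.r a b ↔ ∀ P : PrimeFilter L, IsSaturated t.toSetoid P.carrier →
      (a ∈ P.carrier ↔ b ∈ P.carrier) := by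
  refine ⟨fun hab P hP => hP.mem_iff hab, fun h => ?_⟩
  have ha : t.r (a ⊓ b) a := by
    by_contra hn
    obtain ⟨P, hP, haP, hbP⟩ := exists_saturated_mem_notMem hn
    exact hbP ((h P hP).1 haP)
  have hb : t.r (b ⊓ a) b := by
    by_contra hn
    obtain ⟨P, hP, hbP, haP⟩ := exists_saturated_mem_notMem hn
    exact haP ((h P hP).2 hbP)
  rw [inf_comm] at hb
  exact t.trans (t.symm ha) hb

/-! ### Closed sets of prime filters and congruences -/

theorem theta_r_iff {Z : Set (PrimeFilter L)} {a b : L} :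
    (theta Z).r a b ↔ ∀ P ∈ Z, (a ∈ P.carrier ↔ b ∈ P.carrier) := by
  change beta a ∩ Z = beta b ∩ Z ↔ _
  simp only [Set.ext_iff, Set.mem_inter_iff, and_congr_left_iff]
  rfl

theorem mem_iff_isSaturated_theta {Z : Closeds (PrimeFilter L)} {P : PrimeFilter L} :
    P ∈ Z ↔ IsSaturated (theta (Z : Set (PrimeFilter L))).toSetoid P.carrier := by
  refine ⟨fun hP a b hab => (theta_r_iff.1 hab P hP).1, fun hsat => ?_⟩
  by_contra hPZ
  obtain ⟨_, ⟨⟨a, b⟩, rfl⟩, ⟨haP, hbP⟩, hsub⟩ :=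
    isTopologicalBasis_beta_sdiff_beta.exists_subset_of_mem_open hPZ Z.isClosed.isOpen_compl
  have hab : (theta (Z : Set (PrimeFilter L))).r a (a ⊓ b) := theta_r_iff.2 fun Q hQ => by
    rw [Q.inf_mem_iff, iff_self_and]
    exact fun ha => not_not.1 fun hb => hsub ⟨ha, hb⟩ hQ
  exact hbP (P.inf_mem_iff.1 (hsat hab haP)).2

theorem theta_saturatedPrimes (t : LatticeCon L) :
    theta (saturatedPrimes t.toSetoid : Set (PrimeFilter L)) = t :=
  le_antisymm (fun _ _ hab => r_iff_forall_isSaturated.2 (theta_r_iff.1 hab))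
    fun _ _ hab => theta_r_iff.2 (r_iff_forall_isSaturated.1 hab)

theorem saturatedPrimes_theta (Z : Closeds (PrimeFilter L)) :
    saturatedPrimes (theta (Z : Set (PrimeFilter L))).toSetoid = Z :=
  Closeds.ext (Set.ext fun _ => mem_iff_isSaturated_theta.symm)

theorem theta_le_theta_iff {Y Z : Closeds (PrimeFilter L)} :
    theta (Z : Set (PrimeFilter L)) ≤ theta (Y : Set (PrimeFilter L)) ↔ Y ≤ Z := by
  refine ⟨fun h P hP => ?_, fun h a b hab => ?_⟩
  · exact mem_iff_isSaturated_theta.2 fun a b hab => mem_iff_isSaturated_theta.1 hP (h hab)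
  · exact theta_r_iff.2 fun P hP => theta_r_iff.1 hab P (h hP)

end Saturated

/-- The anti-isomorphism `θ` between the closed sets of prime filters and the congruences. -/
def thetaOrderIso (L : Type*) [DistribLattice L] [BoundedOrder L] :
    Closeds (PrimeFilter L) ≃o (LatticeCon L)ᵒᵈ where
  toFun Z := toDual (theta (Z : Set (PrimeFilter L)))
  invFun t := saturatedPrimes (ofDual t).toSetoid
  left_inv := saturatedPrimes_theta
  right_inv t := theta_saturatedPrimes (ofDual t)
  map_rel_iff' := theta_le_theta_iff

theorem exists_orderIso_theta {A B : Type*} [DistribLattice A] [BoundedOrder A]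
    [DistribLattice B] [BoundedOrder B]
    {p : Closeds (PrimeFilter A) × Closeds (PrimeFilter B) → Prop}
    {q : LatticeCon A × LatticeCon B → Prop}
    (h : ∀ Z, p Z ↔ q (theta (Z.1 : Set _), theta (Z.2 : Set _))) :
    ∃ e : {Z // p Z} ≃o {t // q t}ᵒᵈ,
      ∀ Z, (ofDual (e Z)).1 = (theta (Z.1.1 : Set _), theta (Z.1.2 : Set _)) :=
  ⟨{ toEquiv := (((thetaOrderIso A).toEquiv.trans ofDual).prodCongr
        ((thetaOrderIso B).toEquiv.trans ofDual)).subtypeEquiv h |>.trans toDual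
     map_rel_iff' := and_congr theta_le_theta_iff theta_le_theta_iff }, fun _ => rfl⟩

/-! ### Maps preserving finite joins in each of two variables -/

section BiSupHom

/-- A map of two variables preserves finite joins, including the empty one, in each of them. -/
structure IsBiSupHom {L M N : Type*} [SemilatticeSup L] [OrderBot L] [SemilatticeSup M]
    [OrderBot M] [SemilatticeSup N] [OrderBot N] (f : L → M → N) : Prop where
  map_sup_left : ∀ x y b, f (x ⊔ y) b = f x b ⊔ f y b
  map_sup_right : ∀ x b c, f x (b ⊔ c) = f x b ⊔ f x c
  map_bot_left : ∀ b, f ⊥ b = ⊥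
  map_bot_right : ∀ x, f x ⊥ = ⊥

namespace IsBiSupHom

variable {L M N : Type*} [SemilatticeSup L] [OrderBot L] [SemilatticeSup M] [OrderBot M]
  [SemilatticeSup N] [OrderBot N] {f : L → M → N}

theorem flip (hf : IsBiSupHom f) : IsBiSupHom (Function.swap f) where
  map_sup_left b c x := hf.map_sup_right x b c
  map_sup_right b x y := hf.map_sup_left x y b
  map_bot_left := hf.map_bot_right
  map_bot_right := hf.map_bot_left

theorem mono (hf : IsBiSupHom f) {a c : L} {b d : M} (hac : a ≤ c) (hbd : b ≤ d) :
    f a b ≤ f c d := by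
  rw [← sup_eq_right.2 hac, ← sup_eq_right.2 hbd, hf.map_sup_left, hf.map_sup_right a]
  exact le_sup_left.trans le_sup_left

end IsBiSupHom

variable {L M N : Type*} [DistribLattice L] [BoundedOrder L] [DistribLattice M] [BoundedOrder M]
  [DistribLattice N] [BoundedOrder N] {f : L → M → N}

/-- The ternary relation on prime filters that is dual to a map of two variables. -/
def dualRel (f : L → M → N) (Q : PrimeFilter L) (S : PrimeFilter M) (P : PrimeFilter N) : Prop :=
  ∀ q ∈ Q.carrier, ∀ s ∈ S.carrier, f q s ∈ P.carrier

theorem dualRel_swap_iff {Q : PrimeFilter L} {S : PrimeFilter M} {P : PrimeFilter N} :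
    dualRel (Function.swap f) S Q P ↔ dualRel f Q S P :=
  ⟨fun h q hq s hs => h s hs q hq, fun h s hs q hq => h q hq s hs⟩

theorem dualRel.anti {Q Q' : PrimeFilter L} {S S' : PrimeFilter M} {P : PrimeFilter N}
    (h : dualRel f Q S P) (hQ : Q' ≤ Q) (hS : S' ≤ S) : dualRel f Q' S' P :=
  fun q hq s hs => h q (hQ hq) s (hS hs)

/-- The pairs of `Max(R⁻¹(P))` for the relation `R` that is dual to `f`. -/
def IsMaximalPair (f : L → M → N) (P : PrimeFilter N) (Q : PrimeFilter L) (S : PrimeFilter M) :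
    Prop :=
  Maximal (fun Q' => dualRel f Q' S P) Q ∧ Maximal (fun S' => dualRel f Q S' P) S

namespace IsBiSupHom

/-- The elements `x` with `f x s ∉ P` for some `s` in the filter `G`. When `G` is prime, a prime
filter is related to `G` and `P` exactly if it is disjoint from this ideal. -/
def residualIdeal (hf : IsBiSupHom f) (G : PFilter M) (P : PrimeFilter N) : Ideal L :=
  IsIdeal.toIdeal (I := {x | ∃ s ∈ G, f x s ∉ P.carrier}) <| by
    refine ⟨?_, ⟨⊥, ⊤, G.top_mem, ?_⟩, SupClosed.directedOn ?_⟩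
    · rintro x y hyx ⟨s, hs, hx⟩
      exact ⟨s, hs, fun hy => hx (P.mem_of_le (hf.mono hyx le_rfl) hy)⟩
    · rw [hf.map_bot_left]
      exact P.bot_notMem
    · rintro x ⟨s, hs, hx⟩ y ⟨s', hs', hy⟩
      refine ⟨s ⊓ s', G.inf_mem hs hs', fun h => ?_⟩
      rw [hf.map_sup_left, P.sup_mem_iff] at h
      exact h.elim (fun h => hx (P.mem_of_le (hf.mono le_rfl inf_le_left) h))
        fun h => hy (P.mem_of_le (hf.mono le_rfl inf_le_right) h)

theorem mem_residualIdeal {hf : IsBiSupHom f} {G : PFilter M} {P : PrimeFilter N} {x : L} :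
    x ∈ hf.residualIdeal G P ↔ ∃ s ∈ G, f x s ∉ P.carrier :=
  Iff.rfl

theorem disjoint_residualIdeal_iff (hf : IsBiSupHom f) {Q : PrimeFilter L} {S : PrimeFilter M}
    {P : PrimeFilter N} : Disjoint Q.carrier (hf.residualIdeal S.1 P) ↔ dualRel f Q S P := by
  simp only [Set.disjoint_left, SetLike.mem_coe, mem_residualIdeal, not_exists, not_and, not_not]
  rfl

theorem exists_isMaximalPair (hf : IsBiSupHom f) {P : PrimeFilter N} {a : L} {b : M}
    (hab : f a b ∈ P.carrier) :
    ∃ Q S, IsMaximalPair f P Q S ∧ a ∈ Q.carrier ∧ b ∈ S.carrier := by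
  have ha : a ∉ hf.residualIdeal (PFilter.principal b) P := by
    rintro ⟨s, hs, has⟩
    exact has (P.mem_of_le (hf.mono le_rfl hs) hab)
  obtain ⟨Q₀, haQ₀, hQ₀⟩ := exists_mem_and_maximal_disjoint ha
  have hb : b ∉ hf.flip.residualIdeal Q₀.1 P := by
    rintro ⟨q, hq, hqb⟩
    exact Set.disjoint_left.1 hQ₀.prop hq ⟨b, le_rfl, hqb⟩
  obtain ⟨S, hbS, hS⟩ := exists_mem_and_maximal_disjoint hb
  simp only [disjoint_residualIdeal_iff, dualRel_swap_iff] at hS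
  obtain ⟨Q, hQ₀Q, hQ⟩ :=
    Q₀.exists_le_and_maximal_disjoint (hf.disjoint_residualIdeal_iff.2 hS.prop)
  simp only [disjoint_residualIdeal_iff] at hQ
  exact ⟨Q, S, ⟨hQ, hQ.prop, fun S' hS' hle => hS.le_of_ge (hS'.anti hQ₀Q le_rfl) hle⟩,
    hQ₀Q haQ₀, hbS⟩

theorem isSaturated_of_maximal_dualRel (hf : IsBiSupHom f) {t : LatticeCon L} {r : Setoid N}
    (hcon : ∀ s, (t.r ⇒ r) (fun x => f x s) fun x => f x s) {Q : PrimeFilter L} {S : PrimeFilter M}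
    {P : PrimeFilter N} (hP : IsSaturated r P.carrier)
    (hQ : Maximal (fun Q' => dualRel f Q' S P) Q) : IsSaturated t.toSetoid Q.carrier := by
  have hI : IsSaturated t.toSetoid (hf.residualIdeal S.1 P : Set L) := by
    rintro x y hxy ⟨s, hs, hx⟩
    exact ⟨s, hs, fun hy => hx ((hP.mem_iff (hcon s hxy)).2 hy)⟩
  refine isSaturated_of_maximal_disjoint hI ?_
  simpa only [disjoint_residualIdeal_iff] using hQ

theorem liftFun_iff_forall_isMaximalPair (hf : IsBiSupHom f) {t₁ : LatticeCon L}
    {t₂ : LatticeCon M} {t₃ : LatticeCon N} :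
    (t₁.r ⇒ t₂.r ⇒ t₃.r) f f ↔ ∀ P : PrimeFilter N, IsSaturated t₃.toSetoid P.carrier →
      ∀ Q S, IsMaximalPair f P Q S →
        IsSaturated t₁.toSetoid Q.carrier ∧ IsSaturated t₂.toSetoid S.carrier := by
  refine ⟨fun hcon P hP Q S hQS => ⟨?_, ?_⟩, fun h a c hac b d hbd => ?_⟩
  · exact hf.isSaturated_of_maximal_dualRel (fun s _ _ hxy => hcon hxy (t₂.refl s)) hP hQS.1
  · refine hf.flip.isSaturated_of_maximal_dualRel (fun x _ _ hbd => hcon (t₁.refl x) hbd) hP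
      (S := Q) ?_
    simpa only [dualRel_swap_iff] using hQS.2
  · have hmem : ∀ ⦃a c b d⦄, t₁.r a c → t₂.r b d → ∀ P : PrimeFilter N,
        IsSaturated t₃.toSetoid P.carrier → f a b ∈ P.carrier → f c d ∈ P.carrier := by
      intro a c b d hac hbd P hP hab
      obtain ⟨Q, S, hQS, ha, hb⟩ := hf.exists_isMaximalPair hab
      obtain ⟨hQ, hS⟩ := h P hP Q S hQS
      exact hQS.1.prop c (hQ hac ha) d (hS hbd hb)
    exact r_iff_forall_isSaturated.2 fun P hP =>
      ⟨hmem hac hbd P hP, hmem (t₁.symm hac) (t₂.symm hbd) P hP⟩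

end IsBiSupHom

end BiSupHom

/-! ### Order duality -/

section Dual

variable {L : Type*}

/-- A congruence of a lattice, read on the order dual. -/
def dualCon [Lattice L] (t : LatticeCon L) : LatticeCon Lᵒᵈ where
  r a b := t.r (ofDual a) (ofDual b)
  iseqv := ⟨fun _ => t.refl _, t.symm, t.trans⟩
  inf := t.sup
  sup := t.inf

theorem isSaturated_dualCon_compl_iff [DistribLattice L] [BoundedOrder L] {t : LatticeCon L}
    {P : PrimeFilter L} :
    IsSaturated (dualCon t).toSetoid P.compl.carrier ↔ IsSaturated t.toSetoid P.carrier :=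
  ⟨fun h _ _ hab => not_imp_not.1 (h (t.symm hab)), fun h _ _ hab => mt (h (t.symm hab))⟩

end Dual

section Module

variable {A : Type u} {B : Type v} [DistribLattice A] [BoundedOrder A] [DistribLattice B]
  [BoundedOrder B]

theorem FDLModule.isBiSupHom_f (M : FDLModule A B) : IsBiSupHom M.f where
  map_sup_left := M.f_sup_left
  map_sup_right := M.f_sup_right
  map_bot_left := M.f_bot_left
  map_bot_right := M.f_bot_right

/-- The implication as a map `B × Aᵒᵈ → Aᵒᵈ`. -/
def IDLModule.iDual (M : IDLModule A B) (b : B) (x : Aᵒᵈ) : Aᵒᵈ :=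
  toDual (M.i b (ofDual x))

theorem IDLModule.isBiSupHom_iDual (M : IDLModule A B) (hM : ∀ x, M.i ⊥ x = ⊤) :
    IsBiSupHom M.iDual where
  map_sup_left b c x := M.i_sup b c (ofDual x)
  map_sup_right b x y := M.i_inf b (ofDual x) (ofDual y)
  map_bot_left x := hM (ofDual x)
  map_bot_right := M.i_top

namespace FIDLModule

variable (M : FIDLModule A B)

theorem dualSpace_R_iff {Q P : PrimeFilter A} {S : PrimeFilter B} :
    M.dualSpace.R Q S P ↔ dualRel M.f Q S P :=
  ⟨fun h q hq s hs => h ⟨q, hq, s, hs, le_rfl⟩,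
    fun h _ ⟨q, hq, s, hs, hx⟩ => P.mem_of_le hx (h q hq s hs)⟩

theorem dualSpace_T_iff {Q P : PrimeFilter A} {S : PrimeFilter B} :
    M.dualSpace.T S P Q ↔ dualRel M.iDual S Q.compl P.compl :=
  ⟨fun h s hs _ hx hi => hx (h ⟨s, hs, _, hi, le_rfl⟩),
    fun h x ⟨s, hs, _, hp, hle⟩ => not_not.1 fun hx => h s hs x hx (P.mem_of_le hle hp)⟩

theorem mem_maxR_dualSpace_iff {Q P : PrimeFilter A} {S : PrimeFilter B} :
    (Q, S) ∈ M.dualSpace.maxR P ↔ IsMaximalPair M.f P Q S := by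
  simp only [IsMaximalPair, ← dualSpace_R_iff]
  rfl

theorem mem_D_dualSpace_iff {Q P : PrimeFilter A} {S : PrimeFilter B} :
    (S, Q) ∈ M.dualSpace.D P ↔ IsMaximalPair M.iDual P.compl S Q.compl := by
  simp only [IsMaximalPair, maximal_compl_iff, ← dualSpace_T_iff]
  rfl

theorem isFDLCon_iff {t : LatticeCon A × LatticeCon B} :
    M.IsFDLCon t ↔ (t.1.r ⇒ t.2.r ⇒ t.1.r) M.f M.f :=
  ⟨fun h _ _ hac _ _ hbd => h hac hbd, fun h _ _ _ _ hac hbd => h hac hbd⟩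

theorem isIDLCon_iff {t : LatticeCon A × LatticeCon B} :
    M.IsIDLCon t ↔ (t.2.r ⇒ (dualCon t.1).r ⇒ (dualCon t.1).r) M.iDual M.iDual :=
  ⟨fun h _ _ hbd _ _ hac => h hac hbd, fun h _ _ _ _ hac hbd => h hbd hac⟩

theorem isRClosed_iff_isFDLCon_theta (Z : Closeds (PrimeFilter A) × Closeds (PrimeFilter B)) :
    M.dualSpace.IsRClosed Z ↔ M.IsFDLCon (theta (Z.1 : Set _), theta (Z.2 : Set _)) := by
  rw [isFDLCon_iff, M.isBiSupHom_f.liftFun_iff_forall_isMaximalPair]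
  simp only [← mem_iff_isSaturated_theta, ← mem_maxR_dualSpace_iff]
  exact forall₂_congr fun P _ => Prod.forall

theorem isTClosed_iff_isIDLCon_theta (hM : ∀ x, M.i ⊥ x = ⊤)
    (Z : Closeds (PrimeFilter A) × Closeds (PrimeFilter B)) :
    M.dualSpace.IsTClosed Z ↔ M.IsIDLCon (theta (Z.1 : Set _), theta (Z.2 : Set _)) := by
  rw [isIDLCon_iff, (M.isBiSupHom_iDual hM).liftFun_iff_forall_isMaximalPair]
  simp only [PrimeFilter.compl_surjective.forall, isSaturated_dualCon_compl_iff,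
    ← mem_iff_isSaturated_theta, ← mem_D_dualSpace_iff]
  exact forall₂_congr fun P _ => Prod.forall

end FIDLModule

end Module

theorem mainTheorem5 {A : Type u} {B : Type v} [DistribLattice A] [BoundedOrder A]
    [DistribLattice B] [BoundedOrder B] (M : FIDLModule A B) :
    (∃ e : {Z : Closeds (PrimeFilter A) × Closeds (PrimeFilter B) // M.dualSpace.IsRClosed Z} ≃o
          {t : LatticeCon A × LatticeCon B // M.IsFDLCon t}ᵒᵈ,
        ∀ Z, (OrderDual.ofDual (e Z)).1 = (theta (Z.1.1 : Set _), theta (Z.1.2 : Set _))) ∧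
    ((∀ x : A, M.i ⊥ x = ⊤) →
      (∃ e : {Z : Closeds (PrimeFilter A) × Closeds (PrimeFilter B) //
              M.dualSpace.IsTClosed Z} ≃o
            {t : LatticeCon A × LatticeCon B // M.IsIDLCon t}ᵒᵈ,
          ∀ Z, (OrderDual.ofDual (e Z)).1 = (theta (Z.1.1 : Set _), theta (Z.1.2 : Set _))) ∧
      (∃ e : {Z : Closeds (PrimeFilter A) × Closeds (PrimeFilter B) //
              M.dualSpace.IsStronglyClosed Z} ≃o
            {t : LatticeCon A × LatticeCon B // M.IsFIDLCon t}ᵒᵈ,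
          ∀ Z, (OrderDual.ofDual (e Z)).1 = (theta (Z.1.1 : Set _), theta (Z.1.2 : Set _)))) := by
  refine ⟨exists_orderIso_theta M.isRClosed_iff_isFDLCon_theta, fun hM => ⟨?_, ?_⟩⟩
  · exact exists_orderIso_theta (M.isTClosed_iff_isIDLCon_theta hM)
  · exact exists_orderIso_theta fun Z =>
      and_congr (M.isRClosed_iff_isFDLCon_theta Z) (M.isTClosed_iff_isIDLCon_theta hM Z)
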